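/- Let $B_n(x)$ be the Bernoulli polynomials, $\sum_{n\ge 0} B_n(x)\frac{t^n}{n!}=\frac{t\,e^{xt}}{e^t-1}$, let $\left[{n+r\atop k+r}\right]_r$ be the $r$-Stirling numbers of the first kind, $(x+r)(x+r+1)\cdots(x+r+n-1)=\sum_{k=0}^n\left[{n+r\atop k+r}\right]_r x^k$, and let $H_n^{(p)}=\sum_{k=1}^n k^{-p}$. Let $Y_n$ be the exponential Bell polynomials, $\sum_{n\ge 0}Y_n(x_1,\dots,x_n)\frac{t^n}{n!}=\exp\Big(\sum_{m\ge1}x_m\frac{t^m}{m!}\Big)$, put $$P_n(x_1,\dots,x_n)=(-1)^nY_n\big(-0!\,x_1,-1!\,x_2,\dots,-(n-1)!\,x_n\big)$$ and, for integers $s,m,N\ge 0$, $$P(s,N,m)=P_s\big(H_N^{(1)}-H_m^{(1)},\dots,H_N^{(s)}-H_m^{(s)}\big).$$ For real $x$ let $h_n^{(x)}$ be the hyperharmonic number of order $x$, $\sum_{n\ge0}h_n^{(x)}t^n=-\frac{\ln(1-t)}{(1-t)^x}$. Then: (a) for all integers $q,r,n,l\ge 0$ with $q+r\ge 2$, $$\sum_{k=l}^{n}\left[{n+r\atop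 k+r}\right]_r k(k-1)\cdots(k-l+1)\,B_{k-l}(q)=n!\binom{n+q+r-1}{q+r-2}P(l+1,\,n+q+r-1,\,q+r-2);$$ (b) for all integers $q,r,n,l\ge 0$ (also when $q+r<2$) the left-hand side of (a) equals $n!\,\frac{d^l}{dx^l}h_{n+1}^{(x+r-1)}\Big|_{x=q}$; (c) each function $x\mapsto h_n^{(x)}$ is smooth on $\mathbb R$, and for all integers $q,n,l\ge0$, $$\frac{d^l}{dx^l}h_n^{(x+1)}\Big|_{x=q}=\binom{q+n}{q}P(l+1,\,q+n,\,q).$$ -/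

import Mathlib

open scoped Nat

/-- The generalized harmonic number `H_n^{(p)} = ∑_{k=1}^n 1 / k^p`. -/
def genHarmonic (p n : ℕ) : ℚ :=
  ∑ k ∈ Finset.Icc 1 n, 1 / (k : ℚ) ^ p

/-- The `r`-Stirling number of the first kind `[n+r, k+r]_r`, that is, the coefficient of `x^k` in
`(x + r)(x + r + 1) ⋯ (x + r + n - 1)`. -/
noncomputable def rStirlingFirst (r n k : ℕ) : ℕ :=
  ((ascPochhammer ℕ n).comp (Polynomial.X + Polynomial.C r)).coeff k

/-- The series `∑_{m ≥ 1} x_m t^m / m!` with the indeterminates `x_m` as coefficients. -/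
noncomputable def bellSeries : PowerSeries (MvPolynomial ℕ ℚ) :=
  PowerSeries.mk fun m =>
    if m = 0 then 0 else MvPolynomial.C (1 / (m ! : ℚ)) * MvPolynomial.X m

/-- The partial exponential Bell polynomial `B_{n,k}(x_1, x_2, …)`, determined by
`∑_n B_{n,k} t^n / n! = (∑_{m ≥ 1} x_m t^m / m!)^k / k!`. -/
noncomputable def partialBell (n k : ℕ) : MvPolynomial ℕ ℚ :=
  MvPolynomial.C ((n ! : ℚ) / (k ! : ℚ)) * PowerSeries.coeff n (bellSeries ^ k)

/-- The (complete) exponential Bell polynomial `Y_n = ∑_{k=0}^n B_{n,k}`, determined by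
`∑_n Y_n t^n / n! = exp (∑_{m ≥ 1} x_m t^m / m!)`. -/
noncomputable def completeBell (n : ℕ) : MvPolynomial ℕ ℚ :=
  ∑ k ∈ Finset.range (n + 1), partialBell n k

/-- `P_n(x_1, …, x_n) = (-1)^n Y_n(-0! x_1, -1! x_2, …, -(n-1)! x_n)`
(the indeterminate with index `0` does not occur in `Y_n`). -/
noncomputable def modifiedBell (n : ℕ) : MvPolynomial ℕ ℚ :=
  (-1) ^ n * MvPolynomial.aeval
    (fun i : ℕ => -(MvPolynomial.C ((i - 1)! : ℚ) * MvPolynomial.X i : MvPolynomial ℕ ℚ))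
    (completeBell n)

/-- `P(s, N, m) = P_s(H_N^{(1)} - H_m^{(1)}, …, H_N^{(s)} - H_m^{(s)})`. -/
noncomputable def harmonicBell (s N m : ℕ) : ℚ :=
  MvPolynomial.eval (fun i : ℕ => genHarmonic i N - genHarmonic i m) (modifiedBell s)

/-- The hyperharmonic number `h_n^{(r)}` of natural order `r`: `h_n^{(0)} = 1 / n` and
`h_n^{(r+1)} = ∑_{k=1}^n h_k^{(r)}`. -/
def hyperharmonicNat : ℕ → ℕ → ℚ
  | 0, n => 1 / (n : ℚ)
  | r + 1, n => ∑ k ∈ Finset.Icc 1 n, hyperharmonicNat r k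

/-- The power series `-ln (1 - t) = ∑_{n ≥ 1} t^n / n` (the constant coefficient is `1 / 0 = 0`). -/
noncomputable def negLogSeries : PowerSeries ℝ :=
  PowerSeries.mk fun n => 1 / (n : ℝ)

/-- The binomial series `(1 - t)^(-x) = ∑_k x (x + 1) ⋯ (x + k - 1) / k! t^k`. -/
noncomputable def negPowSeries (x : ℝ) : PowerSeries ℝ :=
  PowerSeries.mk fun k => (ascPochhammer ℝ k).eval x / (k ! : ℝ)

/-- The hyperharmonic number `h_n^{(x)}` of real order `x`, determined by
`∑_n h_n^{(x)} t^n = -ln (1 - t) / (1 - t)^x`. -/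
noncomputable def hyperharmonic (n : ℕ) (x : ℝ) : ℝ :=
  PowerSeries.coeff n (negLogSeries * negPowSeries x)

theorem negPowSeries_eq (x : ℝ) :
    negPowSeries x = negPowSeries (x + 1) * (1 - PowerSeries.X) := by
  ext n
  rw [mul_sub, mul_one, map_sub]
  cases n with
  | zero => simp [negPowSeries]
  | succ k =>
    rw [PowerSeries.coeff_succ_mul_X]
    simp only [negPowSeries, PowerSeries.coeff_mk]
    have h1 : (ascPochhammer ℝ (k + 1)).eval x = x * (ascPochhammer ℝ k).eval (x + 1) := by
      simp [ascPochhammer_succ_left]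
    rw [h1, ascPochhammer_succ_eval, Nat.factorial_succ]
    have := Nat.factorial_ne_zero k
    push_cast
    field_simp
    ring

/-- For natural orders the definition by the generating function agrees with the recursion. -/
theorem hyperharmonic_natCast (r n : ℕ) :
    hyperharmonic n (r : ℝ) = (hyperharmonicNat r n : ℝ) := by
  induction r generalizing n with
  | zero =>
    have : negPowSeries ((0 : ℕ) : ℝ) = 1 := by
      ext k
      rcases k with _ | k <;> simp [negPowSeries, PowerSeries.coeff_one]
    rw [hyperharmonic, this]
    simp [negLogSeries, hyperharmonicNat]
  | succ r ih =>
    induction n with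
    | zero => simp [hyperharmonic, hyperharmonicNat, negLogSeries]
    | succ n ihn =>
      have h := ih (n + 1)
      rw [hyperharmonic, negPowSeries_eq, ← mul_assoc, mul_sub, mul_one, map_sub,
        PowerSeries.coeff_succ_mul_X] at h
      have e : hyperharmonicNat (r + 1) (n + 1)
          = hyperharmonicNat (r + 1) n + hyperharmonicNat r (n + 1) := by
        simp only [hyperharmonicNat]
        rw [Finset.sum_Icc_succ_top (by omega)]
      rw [e]
      simp only [hyperharmonic] at ihn ⊢
      push_cast at ihn ⊢
      linarith

/-! ### The Bernoulli sum as a derivative of a rising factorial. -/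

section Polynomials

open Polynomial

/-! All the quantities are derivatives of order `l + 1` of a rising factorial. The operator `X ^ k ↦
B_k` sends a forward difference `p(X + 1) - p(X)` to `p'`, and `(X + r)⋯(X + r + n - 1)` is, up to
the factor `n + 1`, the difference of `(X + r - 1)⋯(X + r + n - 1)`; this evaluates the sum
(`sum_rStirlingFirst_mul_bernoulli_eval`). Since `-ln(1 - t) (1 - t)^(-x)` is the `x`-derivative of
`(1 - t)^(-x)`, the number `h_n^{(x)}` is the derivative of `x(x + 1)⋯(x + n - 1) / n!`
(`hyperharmonic_eq_derivative_ascPochhammer`). Finally, the Taylor coefficients of the rising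
factorial at `m + 1` are, up to a constant, elementary symmetric functions of `1/(m + 1), …, 1/(m +
n)`. Their power sums are differences of harmonic numbers, and Newton's identities turn these into
`P` (`harmonicBell_div_factorial`). -/

theorem iterate_derivative_comp_X_add_C {R : Type*} [CommSemiring R] (p : R[X]) (a : R) (l : ℕ) :
    derivative^[l] (p.comp (X + C a)) = (derivative^[l] p).comp (X + C a) := by
  induction l with
  | zero => rfl
  | succ l ih => simp only [Function.iterate_succ_apply', ih, derivative_comp]; simp

theorem iterate_derivative_eval_eq_coeff {R : Type*} [CommSemiring R] (p : R[X]) (a : R) (l : ℕ) :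
    (derivative^[l] p).eval a = l ! * (p.comp (X + C a)).coeff l := by
  rw [← taylor_apply, taylor_coeff, ← factorial_smul_hasseDeriv]
  simp

theorem iteratedDeriv_polynomial_eval (p : ℝ[X]) (l : ℕ) (x : ℝ) :
    iteratedDeriv l (fun x => p.eval x) x = (derivative^[l] p).eval x := by
  induction l generalizing p with
  | zero => simp
  | succ l ih =>
    rw [iteratedDeriv_succ', Function.iterate_succ_apply, ← ih]
    congr 1
    ext y
    simp

/-- The linear operator on polynomials taking `X ^ k` to the Bernoulli polynomial `B_k`. -/
noncomputable def bernoulliMap : ℚ[X] →ₗ[ℚ] ℚ[X] :=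
  Polynomial.lsum fun k => LinearMap.toSpanSingleton ℚ ℚ[X] (Polynomial.bernoulli k)

theorem bernoulliMap_monomial (k : ℕ) (c : ℚ) :
    bernoulliMap (monomial k c) = c • Polynomial.bernoulli k := by
  simp [bernoulliMap, Polynomial.lsum_apply]

theorem bernoulliMap_eq_sum {p : ℚ[X]} {n : ℕ} (h : p.natDegree ≤ n) :
    bernoulliMap p = ∑ k ∈ Finset.range (n + 1), p.coeff k • Polynomial.bernoulli k := by
  conv_lhs => rw [p.as_sum_range' (n + 1) (by omega)]
  simp [bernoulliMap_monomial]

/-- The Bernoulli operator inverts the forward difference up to differentiation. -/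
theorem bernoulliMap_comp_X_add_one_sub (p : ℚ[X]) :
    bernoulliMap (p.comp (X + 1) - p) = derivative p := by
  induction p using Polynomial.induction_on' with
  | add p q hp hq =>
    rw [derivative_add, ← hp, ← hq, ← map_add, add_comp]
    congr 1
    ring
  | monomial k c =>
    rcases k with _ | k
    · simp
    -- The top term of the binomial expansion cancels; what remains matches `∑_{j ≤ k} (k+1 choose
    -- j) B_j = (k + 1) X ^ k`.
    have h : (monomial (k + 1) c).comp (X + 1) - monomial (k + 1) c
        = ∑ j ∈ Finset.range (k + 1), monomial j (c * ((k + 1).choose j : ℚ)) := by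
      rw [monomial_comp, add_pow, Finset.sum_range_succ, mul_add, Finset.mul_sum]
      simp only [one_pow, mul_one, Nat.choose_self, Nat.cast_one, C_mul_X_pow_eq_monomial,
        add_sub_cancel_right]
      refine Finset.sum_congr rfl fun j _ => ?_
      rw [← C_mul_X_pow_eq_monomial, C_mul, C_eq_natCast]
      ring
    rw [h, map_sum, derivative_monomial]
    simp only [bernoulliMap_monomial, mul_smul, ← Finset.smul_sum, Polynomial.sum_bernoulli]
    rw [smul_monomial]
    simp

theorem iterate_derivative_bernoulli (k l : ℕ) :
    derivative^[l] (Polynomial.bernoulli k)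
      = (k.descFactorial l : ℚ) • Polynomial.bernoulli (k - l) := by
  induction l with
  | zero => simp
  | succ l ih =>
    rw [Function.iterate_succ_apply', ih, derivative_smul, derivative_bernoulli,
      Nat.descFactorial_succ, Nat.sub_sub, ← C_eq_natCast, ← smul_eq_C_mul, smul_smul]
    push_cast
    rw [mul_comm]

/-- The two products share all but one factor, and the remaining factors differ by `(X + a + n) - (X
+ a - 1) = n + 1`. -/
theorem ascPochhammer_comp_X_add_C_sub (n : ℕ) (a : ℚ) :
    ((ascPochhammer ℚ (n + 1)).comp (X + C (a - 1))).comp (X + 1)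
        - (ascPochhammer ℚ (n + 1)).comp (X + C (a - 1))
      = C (n + 1 : ℚ) * (ascPochhammer ℚ n).comp (X + C a) := by
  have e1 : (X + C (a - 1)).comp (X + 1) = X + C a := by
    rw [add_comp, X_comp, C_comp, C_sub, C_1]
    ring
  have h1 : ((ascPochhammer ℚ (n + 1)).comp (X + C (a - 1))).comp (X + 1)
      = (ascPochhammer ℚ (n + 1)).comp (X + C a) := by
    rw [comp_assoc, e1]
  have h2 : (ascPochhammer ℚ (n + 1)).comp (X + C (a - 1))
      = (X + C (a - 1)) * (ascPochhammer ℚ n).comp (X + C a) := by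
    rw [ascPochhammer_succ_left, mul_comp, X_comp, comp_assoc]
    congr 2
    simp only [add_comp, X_comp, C_sub, one_comp, C_1]
    ring
  rw [h1, h2, ascPochhammer_succ_right]
  simp only [mul_comp, add_comp, X_comp, natCast_comp, C_sub, C_add, C_1, natCast_comp, map_natCast]
  ring

theorem bernoulliMap_ascPochhammer_comp (n : ℕ) (a : ℚ) :
    C (n + 1 : ℚ) * bernoulliMap ((ascPochhammer ℚ n).comp (X + C a))
      = (derivative (ascPochhammer ℚ (n + 1))).comp (X + C (a - 1)) := by
  rw [← smul_eq_C_mul, ← map_smul, smul_eq_C_mul, ← ascPochhammer_comp_X_add_C_sub,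
    bernoulliMap_comp_X_add_one_sub, derivative_comp]
  simp

theorem rStirlingFirst_cast (r n k : ℕ) :
    (rStirlingFirst r n k : ℚ) = ((ascPochhammer ℚ n).comp (X + C (r : ℚ))).coeff k := by
  rw [rStirlingFirst, ← ascPochhammer_map (Nat.castRingHom ℚ)]
  have : (X + C (r : ℚ)) = (X + C r : ℕ[X]).map (Nat.castRingHom ℚ) := by simp
  rw [this, ← map_comp, coeff_map]
  simp

theorem sum_rStirlingFirst_mul_bernoulli_eval (q r n l : ℕ) :
    ∑ k ∈ Finset.Icc l n, (rStirlingFirst r n k : ℚ) * (k.descFactorial l : ℚ) *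
          (Polynomial.bernoulli (k - l)).eval (q : ℚ)
      = (derivative^[l + 1] (ascPochhammer ℚ (n + 1))).eval ((q : ℚ) + r - 1) / (n + 1) := by
  have hdeg : ((ascPochhammer ℚ n).comp (X + C (r : ℚ))).natDegree ≤ n := by
    rw [natDegree_comp, natDegree_X_add_C, mul_one, ascPochhammer_natDegree]
  have hn : (n + 1 : ℚ) ≠ 0 := by positivity
  have h := congrArg (fun p => (derivative^[l] p).eval (q : ℚ))
    (bernoulliMap_ascPochhammer_comp n (r : ℚ))
  simp only [iterate_derivative_comp_X_add_C, iterate_derivative_C_mul, eval_mul, eval_C,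
    eval_comp, eval_add, eval_X, ← Function.iterate_succ_apply] at h
  rw [add_sub_assoc, ← h, mul_div_cancel_left₀ _ hn, bernoulliMap_eq_sum hdeg,
    iterate_derivative_sum, eval_finsetSum]
  simp only [iterate_derivative_smul, iterate_derivative_bernoulli, eval_smul, smul_eq_mul,
    ← rStirlingFirst_cast, ← mul_assoc]
  -- The terms with `k < l` vanish through the falling factorial.
  apply Finset.sum_subset
  · intro k; simp
  · intro k hk hk'
    have : k < l := by simp at hk hk'; omega
    simp [Nat.descFactorial_of_lt this]

end Polynomials

/-! ### Hyperharmonic numbers as derivatives of rising factorials. -/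

section Hyperharmonic

open PowerSeries

theorem one_sub_X_mul_derivative_negLogSeries :
    (1 - X) * d⁄dX ℝ negLogSeries = 1 := by
  have : d⁄dX ℝ negLogSeries = mk 1 := by
    ext n
    rw [coeff_derivative]
    simp only [negLogSeries, coeff_mk, Pi.one_apply]
    push_cast
    field_simp
  rw [this, mul_comm, mk_one_mul_one_sub_eq_one]

theorem one_sub_X_mul_derivative_negPowSeries (x : ℝ) :
    (1 - X) * d⁄dX ℝ (negPowSeries x) = C x * negPowSeries x := by
  ext n
  rw [sub_mul, one_mul, map_sub, coeff_derivative, coeff_C_mul]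
  have h (k : ℕ) : coeff (k + 1) (negPowSeries x) * (k + 1) = coeff k (negPowSeries x) * (x + k) := by
    simp only [negPowSeries, coeff_mk, ascPochhammer_succ_eval, Nat.factorial_succ]
    have := Nat.factorial_ne_zero k
    push_cast
    field_simp
  rw [h]
  rcases n with _ | n
  · simp [mul_comm]
  · rw [coeff_succ_X_mul, coeff_derivative]
    push_cast
    ring

theorem hyperharmonic_zero (x : ℝ) : hyperharmonic 0 x = 0 := by
  simp [hyperharmonic, negLogSeries]

/-- Coefficient of `t ^ n` in `(1 - t) F' = (1 - t)^(-x) + x F`, where `F = -ln(1 - t) (1 -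
t)^(-x)`. -/
theorem succ_mul_hyperharmonic_succ (n : ℕ) (x : ℝ) :
    (n + 1) * hyperharmonic (n + 1) x
      = (ascPochhammer ℝ n).eval x / n ! + (x + n) * hyperharmonic n x := by
  have h : (1 - X) * d⁄dX ℝ (negLogSeries * negPowSeries x)
      = negPowSeries x + C x * (negLogSeries * negPowSeries x) := by
    rw [Derivation.leibniz, smul_eq_mul, smul_eq_mul]
    linear_combination negLogSeries * one_sub_X_mul_derivative_negPowSeries x
      + negPowSeries x * one_sub_X_mul_derivative_negLogSeries
  have h' := congrArg (coeff n) h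
  rw [sub_mul, one_mul, map_sub, map_add, coeff_C_mul, coeff_derivative] at h'
  change hyperharmonic (n + 1) x * _ - _ = _ + x * hyperharmonic n x at h'
  have e : coeff n (X * d⁄dX ℝ (negLogSeries * negPowSeries x)) = n * hyperharmonic n x := by
    rcases n with _ | n
    · simp
    · rw [coeff_succ_X_mul, coeff_derivative, hyperharmonic]
      push_cast
      ring
  rw [e] at h'
  simp only [negPowSeries, coeff_mk] at h'
  linear_combination h'

/-- Differentiating the recursion of the rising factorial in `x` gives the recursion of
`succ_mul_hyperharmonic_succ`, so no series has to be differentiated in `x`. -/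
theorem hyperharmonic_eq_derivative_ascPochhammer (n : ℕ) (x : ℝ) :
    hyperharmonic n x = (Polynomial.derivative (ascPochhammer ℝ n)).eval x / n ! := by
  induction n with
  | zero => simp [hyperharmonic_zero]
  | succ n ih =>
    have h := succ_mul_hyperharmonic_succ n x
    have hn : (n + 1 : ℝ) ≠ 0 := by positivity
    have hf : (n ! : ℝ) ≠ 0 := by positivity
    rw [ih] at h
    rw [ascPochhammer_succ_right, Polynomial.derivative_mul, Nat.factorial_succ]
    simp only [Polynomial.eval_add, Polynomial.eval_mul, Polynomial.derivative_add,
      Polynomial.derivative_X, Polynomial.derivative_natCast, Polynomial.eval_X,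
      Polynomial.eval_natCast, Polynomial.eval_one, add_zero]
    push_cast
    field_simp at h ⊢
    linear_combination h

theorem contDiff_hyperharmonic (n : ℕ) : ContDiff ℝ (⊤ : ℕ∞) (hyperharmonic n) := by
  have : hyperharmonic n = fun x => (Polynomial.derivative (ascPochhammer ℝ n)).eval x / n ! :=
    funext (hyperharmonic_eq_derivative_ascPochhammer n)
  rw [this]
  simpa using (Polynomial.contDiff_aeval (Polynomial.derivative (ascPochhammer ℝ n)) _).div_const _

theorem iteratedDeriv_hyperharmonic_add (n l : ℕ) (a x : ℝ) :
    iteratedDeriv l (fun x => hyperharmonic n (x + a)) x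
      = (Polynomial.derivative^[l + 1] (ascPochhammer ℝ n)).eval (x + a) / n ! := by
  have : (fun x => hyperharmonic n (x + a)) = fun x => (Polynomial.C (n ! : ℝ)⁻¹ *
      (Polynomial.derivative (ascPochhammer ℝ n)).comp
        (Polynomial.X + Polynomial.C a)).eval x := by
    ext y
    simp [hyperharmonic_eq_derivative_ascPochhammer, div_eq_inv_mul]
  rw [this, iteratedDeriv_polynomial_eval, Polynomial.iterate_derivative_C_mul,
    iterate_derivative_comp_X_add_C, Function.iterate_succ_apply]
  simp [div_eq_inv_mul]

theorem eval_iterate_derivative_ascPochhammer_cast (n l : ℕ) (x : ℚ) :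
    (Polynomial.derivative^[l] (ascPochhammer ℝ n)).eval (x : ℝ)
      = ((Polynomial.derivative^[l] (ascPochhammer ℚ n)).eval x : ℚ) := by
  rw [← ascPochhammer_map (algebraMap ℚ ℝ), Polynomial.iterate_derivative_map]
  exact Polynomial.eval_map_apply (algebraMap ℚ ℝ) x

end Hyperharmonic

/-! ### Bell polynomials and Taylor coefficients of rising factorials. -/

section Bell

open PowerSeries

theorem coeff_bellSeries_pow_of_lt {n k : ℕ} (h : n < k) : coeff n (bellSeries ^ k) = 0 := by
  have : X ∣ bellSeries := by simp [X_dvd_iff, bellSeries, ← coeff_zero_eq_constantCoeff_apply]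
  exact X_pow_dvd_iff.mp (pow_dvd_pow_of_dvd this k) n h

/-- A bound `N` independent of `n` allows the sums over `k` and over the antidiagonal to be
exchanged later. -/
theorem inv_factorial_mul_completeBell {n N : ℕ} (h : n ≤ N) :
    MvPolynomial.C (n ! : ℚ)⁻¹ * completeBell n
      = ∑ k ∈ Finset.range (N + 1), MvPolynomial.C (k ! : ℚ)⁻¹ * coeff n (bellSeries ^ k) := by
  rw [completeBell, Finset.mul_sum]
  have hn : (n ! : ℚ) ≠ 0 := by positivity
  trans ∑ k ∈ Finset.range (n + 1), MvPolynomial.C (k ! : ℚ)⁻¹ * coeff n (bellSeries ^ k)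
  · refine Finset.sum_congr rfl fun k _ => ?_
    rw [partialBell, ← mul_assoc, ← MvPolynomial.C_mul]
    congr 2
    field_simp
  · apply Finset.sum_subset
    · intro k; simp; omega
    · intro k _ hk
      rw [coeff_bellSeries_pow_of_lt (by simp at hk; omega), mul_zero]

theorem coeff_derivative_bellSeries (j : ℕ) :
    coeff j (d⁄dX (MvPolynomial ℕ ℚ) bellSeries)
      = MvPolynomial.C (j ! : ℚ)⁻¹ * MvPolynomial.X (j + 1) := by
  rw [coeff_derivative]
  have e : ((j : MvPolynomial ℕ ℚ) + 1) = MvPolynomial.C (j + 1 : ℚ) := by simp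
  simp only [bellSeries, coeff_mk, Nat.succ_ne_zero, if_false]
  rw [e, mul_right_comm, ← MvPolynomial.C_mul, Nat.factorial_succ]
  congr 2
  push_cast
  field_simp

/-- The recurrence of the complete Bell polynomials, the coefficientwise form of
`(exp f)' = exp f * f'`. -/
theorem inv_factorial_mul_completeBell_succ (n : ℕ) :
    MvPolynomial.C (n ! : ℚ)⁻¹ * completeBell (n + 1)
      = ∑ p ∈ Finset.HasAntidiagonal.antidiagonal n,
          (MvPolynomial.C (p.1 ! : ℚ)⁻¹ * completeBell p.1) *
            (MvPolynomial.C (p.2 ! : ℚ)⁻¹ * MvPolynomial.X (p.2 + 1)) := by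
  -- Coefficient form of `(f^(k+1) / (k+1)!)' = (f^k / k!) f'`.
  have h (k : ℕ) : MvPolynomial.C ((k + 1)! : ℚ)⁻¹ * coeff (n + 1) (bellSeries ^ (k + 1)) *
      ((n : MvPolynomial ℕ ℚ) + 1) = ∑ p ∈ Finset.HasAntidiagonal.antidiagonal n,
        (MvPolynomial.C (k ! : ℚ)⁻¹ * coeff p.1 (bellSeries ^ k)) *
          (MvPolynomial.C (p.2 ! : ℚ)⁻¹ * MvPolynomial.X (p.2 + 1)) := by
    have e : ((k + 1 : ℕ) : PowerSeries (MvPolynomial ℕ ℚ))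
        = C (MvPolynomial.C (k + 1 : ℚ)) := by simp
    rw [mul_assoc, ← coeff_derivative, derivative_pow, Nat.add_sub_cancel, e, mul_assoc,
      coeff_C_mul, ← mul_assoc, ← MvPolynomial.C_mul, coeff_mul, Finset.mul_sum]
    refine Finset.sum_congr rfl fun p _ => ?_
    rw [coeff_derivative_bellSeries, ← mul_assoc, Nat.factorial_succ]
    congr 3
    push_cast
    field_simp
  have e1 : MvPolynomial.C (n ! : ℚ)⁻¹ * completeBell (n + 1)
      = MvPolynomial.C ((n + 1)! : ℚ)⁻¹ * completeBell (n + 1) *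
        ((n : MvPolynomial ℕ ℚ) + 1) := by
    have e : ((n : MvPolynomial ℕ ℚ) + 1) = MvPolynomial.C (n + 1 : ℚ) := by simp
    rw [e, mul_right_comm, ← MvPolynomial.C_mul, Nat.factorial_succ]
    congr 2
    push_cast
    field_simp
  rw [e1, inv_factorial_mul_completeBell le_rfl, Finset.sum_range_succ', add_mul, Finset.sum_mul]
  simp only [h]
  rw [Finset.sum_comm]
  have h0 : coeff (n + 1) (bellSeries ^ 0) = 0 := by simp [coeff_one]
  rw [h0, mul_zero, zero_mul, add_zero]
  refine Finset.sum_congr rfl fun p hp => ?_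
  rw [inv_factorial_mul_completeBell (Finset.HasAntidiagonal.antidiagonal.fst_le hp), Finset.sum_mul]

theorem harmonicBell_zero (N m : ℕ) : harmonicBell 0 N m = 1 := by
  simp [harmonicBell, modifiedBell, completeBell, partialBell]

/-- This is Newton's identity, with the harmonic differences as power sums. -/
theorem harmonicBell_succ (s N m : ℕ) :
    harmonicBell (s + 1) N m / s ! = ∑ p ∈ Finset.HasAntidiagonal.antidiagonal s,
      harmonicBell p.1 N m / p.1 ! *
        ((-1) ^ p.2 * (genHarmonic (p.2 + 1) N - genHarmonic (p.2 + 1) m)) := by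
  set ψ : MvPolynomial ℕ ℚ →+* ℚ :=
    (MvPolynomial.eval fun i : ℕ => genHarmonic i N - genHarmonic i m).comp
      (MvPolynomial.aeval (fun i : ℕ =>
        -(MvPolynomial.C ((i - 1)! : ℚ) * MvPolynomial.X i : MvPolynomial ℕ ℚ))).toRingHom with hψ
  have hC (c : ℚ) : ψ (MvPolynomial.C c) = c := by simp [hψ]
  have hX (j : ℕ) : ψ (MvPolynomial.X (j + 1))
      = -(j ! * (genHarmonic (j + 1) N - genHarmonic (j + 1) m)) := by simp [hψ]
  have hB (k : ℕ) : harmonicBell k N m = (-1) ^ k * ψ (completeBell k) := by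
    simp [hψ, harmonicBell, modifiedBell]
  have h := congrArg ψ (inv_factorial_mul_completeBell_succ s)
  simp only [map_mul, map_sum, hC, hX] at h
  rw [hB, mul_div_assoc, div_eq_inv_mul, h, Finset.mul_sum]
  refine Finset.sum_congr rfl fun p hp => ?_
  rw [hB, ← Finset.HasAntidiagonal.mem_antidiagonal.mp hp]
  have h1 : (p.2 ! : ℚ) ≠ 0 := by positivity
  have h2 : ((-1 : ℚ) ^ p.2) * (-1) ^ p.2 = 1 := by rw [← mul_pow]; simp
  field_simp
  ring

/-- Logarithmic derivative: each factor contributes `a / (1 + a X) = ∑ (-1)^j a^(j+1) X^j`. -/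
theorem derivative_prod_one_add_C_mul_X (a : ℕ → ℚ) (n : ℕ) :
    d⁄dX ℚ (∏ i ∈ Finset.range n, (1 + C (a i) * X))
      = (∏ i ∈ Finset.range n, (1 + C (a i) * X)) *
        mk fun j => (-1) ^ j * ∑ i ∈ Finset.range n, a i ^ (j + 1) := by
  induction n with
  | zero => ext; simp
  | succ n ih =>
    have key : (1 + C (a n) * X) * mk (fun j => (-1) ^ j * a n ^ (j + 1)) = C (a n) := by
      ext j
      rw [add_mul, one_mul, mul_assoc, map_add, coeff_C_mul]
      rcases j with _ | j
      · simp
      · rw [coeff_succ_X_mul, coeff_C]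
        simp only [coeff_mk, Nat.succ_ne_zero, if_false]
        ring
    have hs : (mk fun j => (-1) ^ j * ∑ i ∈ Finset.range (n + 1), a i ^ (j + 1))
        = (mk fun j => (-1) ^ j * ∑ i ∈ Finset.range n, a i ^ (j + 1))
          + mk (fun j => (-1) ^ j * a n ^ (j + 1)) := by
      ext j
      simp [Finset.sum_range_succ, mul_add]
    have hd : d⁄dX ℚ (1 + C (a n) * X) = C (a n) := by
      simp
    rw [Finset.prod_range_succ, Derivation.leibniz, ih, hd, hs, smul_eq_mul, smul_eq_mul]
    linear_combination -(∏ i ∈ Finset.range n, (1 + C (a i) * X)) * key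

theorem genHarmonic_add_sub (p m n : ℕ) :
    genHarmonic p (m + n) - genHarmonic p m
      = ∑ i ∈ Finset.range n, ((m + 1 + i : ℚ)⁻¹) ^ p := by
  induction n with
  | zero => simp
  | succ n ih =>
    rw [Finset.sum_range_succ, ← ih, genHarmonic, ← add_assoc, Finset.sum_Icc_succ_top (by omega),
      ← genHarmonic]
    push_cast
    rw [one_div, inv_pow, add_right_comm (m : ℚ) 1]
    ring

/-- `P(s, m + n, m) / s!` is the `s`-th elementary symmetric function of
`1 / (m + 1), …, 1 / (m + n)`. -/
theorem harmonicBell_div_factorial (s m n : ℕ) :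
    harmonicBell s (m + n) m / s !
      = coeff s (∏ i ∈ Finset.range n, (1 + C ((m + 1 + i : ℚ)⁻¹) * X)) := by
  induction s using Nat.strong_induction_on with
  | _ s ih =>
    rcases s with _ | s
    · simp [harmonicBell_zero, map_prod]
    -- The coefficients of the product satisfy the recurrence `harmonicBell_succ`.
    have h := congrArg (coeff s) (derivative_prod_one_add_C_mul_X (fun i => (m + 1 + i : ℚ)⁻¹) n)
    rw [coeff_derivative, coeff_mul] at h
    have hs : (s + 1 : ℚ) ≠ 0 := by positivity
    have hf : (s ! : ℚ) ≠ 0 := by positivity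
    rw [← mul_left_inj' hs, h, Nat.factorial_succ]
    trans harmonicBell (s + 1) (m + n) m / (s ! : ℚ)
    · push_cast
      field_simp
    rw [harmonicBell_succ]
    refine Finset.sum_congr rfl fun p hp => ?_
    rw [ih p.1 (Nat.lt_succ_of_le (Finset.HasAntidiagonal.antidiagonal.fst_le hp)), coeff_mk,
      genHarmonic_add_sub]

theorem ascPochhammer_comp_X_add_C (n m : ℕ) :
    (((ascPochhammer ℚ n).comp (Polynomial.X + Polynomial.C (m + 1 : ℚ)) : Polynomial ℚ) :
        PowerSeries ℚ)
      = C ((m + 1).ascFactorial n : ℚ) *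
        ∏ i ∈ Finset.range n, (1 + C ((m + 1 + i : ℚ)⁻¹) * X) := by
  induction n with
  | zero => simp
  | succ n ih =>
    have hn : (m + 1 + n : ℚ) ≠ 0 := by positivity
    have key : (X : PowerSeries ℚ) + C (m + 1 + n : ℚ)
        = C (m + 1 + n : ℚ) * (1 + C ((m + 1 + n : ℚ)⁻¹) * X) := by
      rw [mul_add, ← mul_assoc, ← map_mul, mul_inv_cancel₀ hn]
      simp [add_comm]
    have e : ((Polynomial.X + (n : Polynomial ℚ)).comp
        (Polynomial.X + Polynomial.C (m + 1 : ℚ))) =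
        Polynomial.X + Polynomial.C (m + 1 + n : ℚ) := by
      simp [add_assoc]
    rw [ascPochhammer_succ_right, Polynomial.mul_comp, Polynomial.coe_mul, ih, e,
      Polynomial.coe_add, Polynomial.coe_X, Polynomial.coe_C, key, Finset.prod_range_succ,
      Nat.ascFactorial_succ]
    push_cast
    rw [map_mul]
    ring

/-- Taylor expansion at `q + 1`; the constant `(q + 1)⋯(q + n)` divided by `n!` is the binomial
coefficient. -/
theorem eval_iterate_derivative_ascPochhammer (q n s : ℕ) :
    (Polynomial.derivative^[s] (ascPochhammer ℚ n)).eval (q + 1 : ℚ) / n !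
      = ((q + n).choose q : ℚ) * harmonicBell s (q + n) q := by
  have hs : (s ! : ℚ) ≠ 0 := by positivity
  have hn : (n ! : ℚ) ≠ 0 := by positivity
  rw [iterate_derivative_eval_eq_coeff, ← Polynomial.coeff_coe, ascPochhammer_comp_X_add_C,
    coeff_C_mul, ← harmonicBell_div_factorial, Nat.ascFactorial_eq_factorial_mul_choose,
    Nat.choose_symm_add]
  push_cast
  field_simp

end Bell

theorem theorem2 :
    -- the sum formula
    (∀ q r n l : ℕ, 2 ≤ q + r →
      ∑ k ∈ Finset.Icc l n, (rStirlingFirst r n k : ℚ) * (k.descFactorial l : ℚ) *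
          (Polynomial.bernoulli (k - l)).eval (q : ℚ)
        = (n ! : ℚ) * ((n + q + r - 1).choose (q + r - 2) : ℚ) *
          harmonicBell (l + 1) (n + q + r - 1) (q + r - 2)) ∧
    -- the sum as a derivative of a hyperharmonic number, for all nonnegative `q` and `r`
    (∀ q r n l : ℕ,
      ((∑ k ∈ Finset.Icc l n, (rStirlingFirst r n k : ℚ) * (k.descFactorial l : ℚ) *
          (Polynomial.bernoulli (k - l)).eval (q : ℚ) : ℚ) : ℝ)
        = (n ! : ℝ) * iteratedDeriv l (fun x : ℝ => hyperharmonic (n + 1) (x + r - 1)) q) ∧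
    -- the derivatives of the hyperharmonic numbers
    (∀ n : ℕ, ContDiff ℝ (⊤ : ℕ∞) (hyperharmonic n)) ∧
    (∀ q n l : ℕ,
      iteratedDeriv l (fun x : ℝ => hyperharmonic n (x + 1)) q
        = ((q + n).choose q : ℝ) * (harmonicBell (l + 1) (q + n) q : ℝ)) := by
  refine ⟨fun q r n l h => ?_, fun q r n l => ?_, contDiff_hyperharmonic, fun q n l => ?_⟩
  -- With `m = q + r - 2` the evaluation point `q + r - 1` becomes `m + 1`, where no factor of the
  -- rising factorial vanishes.
  · obtain ⟨m, hm⟩ := Nat.exists_eq_add_of_le h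
    have e1 : n + q + r - 1 = m + (n + 1) := by omega
    have e2 : q + r - 2 = m := by omega
    have e3 : (q : ℚ) + r - 1 = m + 1 := by
      have : (q : ℚ) + r = 2 + m := by exact_mod_cast hm
      linarith
    have hn : (n ! : ℚ) ≠ 0 := by positivity
    rw [sum_rStirlingFirst_mul_bernoulli_eval, e1, e2, e3, mul_assoc,
      ← eval_iterate_derivative_ascPochhammer, Nat.factorial_succ]
    push_cast
    field_simp
  · have hn : (n ! : ℝ) ≠ 0 := by positivity
    have e : ((q : ℝ) + (r - 1)) = (((q : ℚ) + r - 1 : ℚ) : ℝ) := by push_cast; ring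
    simp only [add_sub_assoc (_ : ℝ) (r : ℝ) 1]
    rw [sum_rStirlingFirst_mul_bernoulli_eval, iteratedDeriv_hyperharmonic_add, e,
      eval_iterate_derivative_ascPochhammer_cast, Nat.factorial_succ]
    push_cast
    field_simp
  · have e : ((q : ℝ) + 1) = ((q + 1 : ℚ) : ℝ) := by push_cast; ring
    rw [iteratedDeriv_hyperharmonic_add, e, eval_iterate_derivative_ascPochhammer_cast]
    exact_mod_cast congrArg (Rat.cast : ℚ → ℝ) (eval_iterate_derivative_ascPochhammer q n (l + 1))
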